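/- Let $\mathbf Z$ be a Prüfer domain (an integral domain in which every nonzero finitely generated ideal is invertible) of Krull dimension $\le 1$, with field of fractions $\mathbf K$. A \emph{pseudo-matrix} $(\mathfrak h_1,\dots,\mathfrak h_n;\mathfrak e_1,\dots,\mathfrak e_m;A)$ consists of invertible fractional ideals $\mathfrak h_i$ (row ideals) and $\mathfrak e_j$ (column ideals) of $\mathbf Z$ and a matrix $A=(a_{ij})\in\mathbf K^{n\times m}$ with $a_{ij}\mathfrak e_j\subseteq\mathfrak h_i$ for all $i,j$. Pseudo-matrices are multiplied by $$(\mathfrak c;\mathfrak h;B)\cdot(\mathfrak h;\mathfrak e;A)=(\mathfrak c;\mathfrak e;BA);$$ a square pseudo-matrix $(\mathfrak h;\mathfrak e;A)$ is invertible if there is a pseudo-matrix $(\mathfrak e;\mathfrak h;B)$ with $AB=BA=\mathrm I$. Two pseudo-matrices $A$, $A'$ of the same size are \emph{equivalent} if $LAC=A'$ for some invertible pseudo-matrices $L$, $C$ of suitable row and column ideals. An ordinary matrix over $\mathbf Z$ is regarded as a pseudo-matrix all of whose row and column ideals are $\langle 1\rangle$. For a matrix $M$ over $\mathbf Z$, $\mathfrak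 D_k(M)$ denotes the ideal of $\mathbf Z$ generated by the minors of order $k$ of $M$. \textbf{Theorem.} Let $M\in\mathbf M_{n,m}(\mathbf Z)$ be a matrix with $\mathfrak D_n(M)\ne 0$, and let $\delta$ be a nonzero element of $\mathfrak D_n(M)$. Then $n\le m$, and there are invertible fractional ideals $\mathfrak a_1,\dots,\mathfrak a_m$ of $\mathbf Z$ such that $M$ is equivalent to the pseudo-matrix $$M_1=(\langle1\rangle,\dots,\langle1\rangle;\ \mathfrak a_1,\dots,\mathfrak a_m;\ [\,\mathrm I_n\mid 0\,])$$ and such that $\mathfrak a_1\supseteq\mathfrak a_2\supseteq\cdots\supseteq\mathfrak a_n$, $\prod_{i=1}^n\mathfrak a_i=\mathfrak D_n(M)$, each $\mathfrak a_i$ with $1\le i\le n$ is of the form $\langle a_i,\delta\rangle$ for some $a_i\in\mathbf Z$, and $\bigoplus_{k=1}^m\mathfrak a_k\simeq\mathbf Z^m$ as $\mathbf Z$-modules. -/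

import Mathlib

open scoped nonZeroDivisors DirectSum

/-- A Prüfer domain: an integral domain in which every nonzero finitely generated ideal `I` is
invertible, that is, `I * J = ⟨c⟩` for some finitely generated ideal `J` and some `c ≠ 0`. -/
class IsPruferDomain (R : Type*) [CommRing R] : Prop extends IsDomain R where
  exists_mul_eq_span_singleton : ∀ I : Ideal R, I.FG → I ≠ ⊥ →
    ∃ J : Ideal R, J.FG ∧ ∃ c : R, c ≠ 0 ∧ I * J = Ideal.span {c}

/-- The determinantal ideal of order `k` of a matrix: the ideal generated by the minors of
order `k` (rows and columns being extracted in increasing order). -/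
def Matrix.determinantalIdeal {R : Type*} [CommRing R] {n m : ℕ} (k : ℕ)
    (M : Matrix (Fin n) (Fin m) R) : Ideal R :=
  Ideal.span (Set.range fun p : (Fin k ↪o Fin n) × (Fin k ↪o Fin m) =>
    (M.submatrix p.1 p.2).det)

/-- A pseudo-matrix with row ideals `h i` and column ideals `e j`, which are invertible
fractional ideals: a matrix `(a i j)` with entries in the field of fractions `K`
such that `a i j • e j ⊆ h i` for all `i`, `j`. -/
@[ext]
structure PseudoMatrix {R K : Type*} [CommRing R] [Field K] [Algebra R K] {ι κ : Type*}
    (h : ι → (FractionalIdeal R⁰ K)ˣ) (e : κ → (FractionalIdeal R⁰ K)ˣ) where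
  /-- The underlying matrix over the field of fractions. -/
  mat : Matrix ι κ K
  mul_mem : ∀ i j, ∀ x ∈ (e j : FractionalIdeal R⁰ K),
    mat i j * x ∈ (h i : FractionalIdeal R⁰ K)

namespace PseudoMatrix

variable {R K : Type*} [CommRing R] [Field K] [Algebra R K]

/-- An ordinary matrix, seen as a pseudo-matrix whose row and column ideals all equal `⟨1⟩`. -/
def ofMatrix {ι κ : Type*} (M : Matrix ι κ R) :
    PseudoMatrix (fun _ : ι => (1 : (FractionalIdeal R⁰ K)ˣ))
      (fun _ : κ => (1 : (FractionalIdeal R⁰ K)ˣ)) where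
  mat := M.map (algebraMap R K)
  mul_mem := by
    intro i j x hx
    rw [Units.val_one, FractionalIdeal.mem_one_iff] at hx ⊢
    obtain ⟨y, rfl⟩ := hx
    exact ⟨M i j * y, by simp⟩

/-- The product of `B = (c; h; B)` and `A = (h; e; A)` is `(c; e; B * A)`. -/
def mul {ι κ μ : Type*} [Fintype κ] {c : ι → (FractionalIdeal R⁰ K)ˣ}
    {h : κ → (FractionalIdeal R⁰ K)ˣ} {e : μ → (FractionalIdeal R⁰ K)ˣ}
    (B : PseudoMatrix c h) (A : PseudoMatrix h e) : PseudoMatrix c e where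
  mat := B.mat * A.mat
  mul_mem := by
    intro i j x hx
    rw [Matrix.mul_apply, Finset.sum_mul]
    refine Submodule.sum_mem ((c i : FractionalIdeal R⁰ K) : Submodule R K) fun k _ => ?_
    rw [mul_assoc]
    exact B.mul_mem i k _ (A.mul_mem k j x hx)

/-- The identity pseudo-matrix on a family of row (and column) ideals. -/
def one {ι : Type*} [DecidableEq ι] (e : ι → (FractionalIdeal R⁰ K)ˣ) : PseudoMatrix e e where
  mat := 1
  mul_mem := by
    intro i j x hx
    by_cases hij : i = j
    · subst hij
      simpa using hx
    · rw [Matrix.one_apply_ne hij, zero_mul]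
      exact Submodule.zero_mem ((e i : FractionalIdeal R⁰ K) : Submodule R K)

/-- A square pseudo-matrix is invertible if it has a two-sided inverse pseudo-matrix. -/
def IsInvertible {ι : Type*} [Fintype ι] [DecidableEq ι] {h e : ι → (FractionalIdeal R⁰ K)ˣ}
    (A : PseudoMatrix h e) : Prop :=
  ∃ B : PseudoMatrix e h, A.mul B = one h ∧ B.mul A = one e

/-- Two pseudo-matrices `A`, `A'` of the same format are equivalent if `L * A * C = A'` for
some invertible pseudo-matrices `L`, `C` (changes of pseudo-bases). -/
def Equivalent {ι κ : Type*} [Fintype ι] [DecidableEq ι] [Fintype κ] [DecidableEq κ]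
    {h h' : ι → (FractionalIdeal R⁰ K)ˣ} {e e' : κ → (FractionalIdeal R⁰ K)ˣ}
    (A : PseudoMatrix h e) (A' : PseudoMatrix h' e') : Prop :=
  ∃ (L : PseudoMatrix h' h) (C : PseudoMatrix e e'),
    L.IsInvertible ∧ C.IsInvertible ∧ (L.mul A).mul C = A'

end PseudoMatrix

/-! The column module `P` = Im `M` contains `δRⁿ` by Cramer's rule, so it can be studied modulo `δ`.
Dimension at most one makes `R/δ` zero-dimensional, and the Prüfer condition then makes divisibility
in `R/δ` total up to a splitting by an idempotent. On each component one can argue as over a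
valuation ring.

Hence some linear form with coefficient one on the first coordinate takes on `P` a value which,
together with `δ`, generates an ideal `J` containing all coordinates of all elements of `P`. Taking
this form as first coordinate and clearing the others splits `P` as `J × P'`, and induction turns
`P` into a product of a decreasing chain of ideals `⟨aᵢ, δ⟩`
(`exists_linearEquiv_mem_iff_forall_mem_span`). The maximal determinantal ideal depends only on `P`,
hence equals the product of these ideals (`determinantalIdeal_eq_prod`).

Finally `Rᵐ` maps onto this product of invertible, hence projective, ideals. The surjection splits,
and a pseudo-basis of its kernel supplies the remaining column ideals
(`exists_pseudoBasis_of_surjective`). In the resulting pseudo-basis of `Rᵐ` the matrix is `[I | 0]`.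
-/

/-! ### Divisibility modulo `δ`. -/

/-- In a Prüfer domain the divisibility relation is total up to a partition of unity. -/
theorem IsPruferDomain.exists_dvd_mul {R : Type*} [CommRing R] [IsPruferDomain R] (a b : R) :
    ∃ s : R, a ∣ s * b ∧ b ∣ (1 - s) * a := by
  by_cases hab : Ideal.span {a, b} = ⊥
  · rw [Ideal.span_eq_bot] at hab
    have ha : a = 0 := hab a (by simp)
    have hb : b = 0 := hab b (by simp)
    exact ⟨0, by simp, by simp [ha]⟩
  · obtain ⟨J, -, c, hc, hJ⟩ := IsPruferDomain.exists_mul_eq_span_singleton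
      (Ideal.span {a, b}) (Submodule.fg_span (Set.toFinite _)) hab
    have hmem : ∀ z ∈ J, ∀ w ∈ Ideal.span {a, b}, ∃ t, w * z = c * t := fun z hz w hw =>
      Ideal.mem_span_singleton.1 (hJ ▸ Ideal.mul_mem_mul hw hz)
    have ha : a ∈ Ideal.span {a, b} := Ideal.subset_span (by simp)
    have hb : b ∈ Ideal.span {a, b} := Ideal.subset_span (by simp)
    have hcJ : c ∈ Ideal.span {a} * J ⊔ Ideal.span {b} * J := by
      rw [← Ideal.sup_mul, ← Ideal.span_union, Set.singleton_union, hJ]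
      exact Ideal.mem_span_singleton_self c
    obtain ⟨x', hx', y', hy', hxy⟩ := Submodule.mem_sup.1 hcJ
    obtain ⟨x, hx, rfl⟩ := Ideal.mem_span_singleton_mul.1 hx'
    obtain ⟨y, hy, rfl⟩ := Ideal.mem_span_singleton_mul.1 hy'
    -- With `c = a x + b y`, the element is `s = a x / c`, so `1 - s = b y / c`.
    obtain ⟨s, hs⟩ := hmem x hx a ha
    obtain ⟨t, ht⟩ := hmem x hx b hb
    obtain ⟨r, hr⟩ := hmem y hy a ha
    refine ⟨s, ⟨t, mul_left_cancel₀ hc ?_⟩, ⟨r, mul_left_cancel₀ hc ?_⟩⟩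
    · linear_combination (-b) * hs + a * ht
    · linear_combination (-a) * hxy + a * hs + b * hr

/-- Modulo a nonzero element, a ring of dimension at most one is zero-dimensional. -/
theorem Ring.DimensionLEOne.exists_dvd_pow_mul {R : Type*} [CommRing R] [Ring.DimensionLEOne R]
    {δ : R} (hδ : δ ≠ 0) (s : R) : ∃ (k : ℕ) (y : R), δ ∣ s ^ k * (1 - s * y) := by
  -- A prime containing `δ` and disjoint from `S` would be maximal. Then `s` lies in it or is
  -- invertible modulo it, and either way it meets `S`.
  let S : Submonoid R :=
    { carrier := {x | ∃ (k : ℕ) (y : R), x = s ^ k * (1 - s * y)}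
      one_mem' := ⟨0, 0, by simp⟩
      mul_mem' := by
        rintro _ _ ⟨k, y, rfl⟩ ⟨l, z, rfl⟩
        exact ⟨k + l, y + z - s * y * z, by ring⟩ }
  by_cases hd : Disjoint (Ideal.span {δ} : Set R) (S : Set R)
  · obtain ⟨p, hp, hle, hpS⟩ := Ideal.exists_le_prime_disjoint _ S hd
    have hδp : δ ∈ p := hle (Ideal.mem_span_singleton_self δ)
    have hmax : p.IsMaximal := hp.isMaximal fun h => hδ (by simpa [h] using hδp)
    have hs : s ∉ p := fun h => Set.disjoint_left.1 hpS h ⟨1, 0, by simp⟩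
    obtain ⟨y, i, hi, hy⟩ := hmax.exists_inv hs
    refine absurd (show (1 - s * y) ∈ p from ?_)
      (fun h => Set.disjoint_left.1 hpS h ⟨0, y, by simp⟩)
    rwa [← hy, show y * s + i - s * y = i by ring]
  · obtain ⟨x, hx, k, y, rfl⟩ := Set.not_disjoint_iff.1 hd
    exact ⟨k, y, Ideal.mem_span_singleton.1 hx⟩

section Arithmetic

variable {R : Type*} [CommRing R] [IsPruferDomain R] [Ring.DimensionLEOne R] {δ : R}

/-- Divisibility modulo `δ` is total up to an idempotent modulo `δ`. -/
theorem exists_idempotent_mod_dvd (hδ : δ ≠ 0) (a b : R) : ∃ e : R, δ ∣ e * (1 - e) ∧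
    e * b ∈ Ideal.span {a, δ} ∧ (1 - e) * a ∈ Ideal.span {b, δ} := by
  obtain ⟨s, ⟨t, ht⟩, ⟨r, hr⟩⟩ := IsPruferDomain.exists_dvd_mul a b
  obtain ⟨k, y, hk⟩ := Ring.DimensionLEOne.exists_dvd_pow_mul hδ s
  have hk1 : δ ∣ s ^ (k + 1) * (1 - s * y) := by
    rw [pow_succ, mul_right_comm]
    exact hk.mul_right s
  obtain ⟨w, hw⟩ := hk1
  obtain ⟨v, hv⟩ : 1 - s * y ∣ 1 - (s * y) ^ (k + 1) := by
    simpa using sub_dvd_pow_sub_pow (1 : R) (s * y) (k + 1)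
  obtain ⟨v', hv'⟩ : 1 - s ∣ 1 - s ^ (k + 1) := by
    simpa using sub_dvd_pow_sub_pow (1 : R) s (k + 1)
  -- This `e` is a multiple of `s`, so `a` divides `e b`. Modulo `δ`, `1 - e` kills `s ^ (k + 1)`,
  -- so `(1 - e) a` is congruent to a multiple of `(1 - s) a`, hence of `b`.
  refine ⟨(s * y) ^ (k + 1), ⟨y ^ (k + 1) * w * v, ?_⟩, ?_, ?_⟩
  · rw [hv, mul_pow]
    linear_combination (y ^ (k + 1) * v) * hw
  · refine Ideal.mem_span_pair.2 ⟨s ^ k * y ^ (k + 1) * t, 0, ?_⟩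
    rw [mul_pow, pow_succ s]
    linear_combination (-(s ^ k * y ^ (k + 1))) * ht
  · refine Ideal.mem_span_pair.2 ⟨(1 - (s * y) ^ (k + 1)) * v' * r, w * v * a, ?_⟩
    linear_combination (-((1 - (s * y) ^ (k + 1)) * v')) * hr
      - ((1 - (s * y) ^ (k + 1)) * a) * hv' - v * a * hw - (s ^ (k + 1) * a) * hv

theorem exists_mem_span_add_mul (hδ : δ ≠ 0) (a b : R) :
    ∃ c : R, b ∈ Ideal.span {a + c * b, δ} := by
  obtain ⟨e, ⟨z, h0⟩, hb, ha⟩ := exists_idempotent_mod_dvd hδ a b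
  obtain ⟨t, r, h1⟩ := Ideal.mem_span_pair.1 hb
  obtain ⟨u, r', h2⟩ := Ideal.mem_span_pair.1 ha
  -- Modulo `δ`: where `e = 1`, the sum is `a`, which divides `b`; where `e = 0`, `a = u b` and the
  -- sum is `b`.
  refine ⟨(1 - e) * (1 - u), Ideal.mem_span_pair.2 ⟨(1 - e) + e * t,
    -((1 - e) * r' + z * a - z * (1 - u) * b - z * b - e * r + z * t * (1 - u) * b), ?_⟩⟩
  linear_combination (a - (1 - u) * b - b + t * (1 - u) * b) * h0 + e * h1 - (1 - e) * h2

/-- A finitely generated ideal containing `δ`, given as the image of a module under a linear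
form, is generated by `δ` and one value of the form. -/
theorem exists_mem_forall_mem_span (hδ : δ ≠ 0) {E : Type*} [AddCommGroup E] [Module R E]
    {Q : Submodule R E} (hQ : Q.FG) (f : E →ₗ[R] R) :
    ∃ q ∈ Q, ∀ x ∈ Q, f x ∈ Ideal.span {f q, δ} := by
  induction Q, hQ using Submodule.fg_induction with
  | singleton x =>
    refine ⟨x, Submodule.mem_span_singleton_self x, fun y hy => ?_⟩
    obtain ⟨c, rfl⟩ := Submodule.mem_span_singleton.1 hy
    rw [map_smul, smul_eq_mul]
    exact Ideal.mul_mem_left _ _ (Ideal.subset_span (by simp))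
  | sup M₁ M₂ h₁ h₂ ih₁ ih₂ =>
    obtain ⟨q₁, hq₁, H₁⟩ := ih₁
    obtain ⟨q₂, hq₂, H₂⟩ := ih₂
    obtain ⟨c, hc⟩ := exists_mem_span_add_mul hδ (f q₁) (f q₂)
    refine ⟨q₁ + c • q₂, Submodule.add_mem_sup hq₁ (M₂.smul_mem c hq₂), fun x hx => ?_⟩
    rw [map_add, map_smul, smul_eq_mul]
    set J := Ideal.span {f q₁ + c * f q₂, δ}
    have hδJ : δ ∈ J := Ideal.subset_span (by simp)
    have hgJ : f q₁ + c * f q₂ ∈ J := Ideal.subset_span (by simp)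
    have h1J : f q₁ ∈ J := (J.add_mem_iff_left (J.mul_mem_left c hc)).1 hgJ
    obtain ⟨y, hy, z, hz, rfl⟩ := Submodule.mem_sup.1 hx
    rw [map_add]
    refine J.add_mem (Ideal.span_le.2 ?_ (H₁ y hy)) (Ideal.span_le.2 ?_ (H₂ z hz)) <;>
    · rintro w (rfl | rfl) <;> assumption

/-- The coefficient of `f` stays equal to one, so that a coordinate form `f` can later be replaced
by the combination in a change of basis. -/
theorem exists_forall_mem_span_add_smul (hδ : δ ≠ 0) {E : Type*} [AddCommGroup E] [Module R E]
    {Q : Submodule R E} (hQ : Q.FG) (f g : E →ₗ[R] R) :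
    ∃ c : R, ∃ q ∈ Q, ∀ x ∈ Q, f x ∈ Ideal.span {(f + c • g) q, δ} ∧
      g x ∈ Ideal.span {(f + c • g) q, δ} := by
  obtain ⟨q₁, hq₁, H₁⟩ := exists_mem_forall_mem_span hδ hQ f
  obtain ⟨q₂, hq₂, H₂⟩ := exists_mem_forall_mem_span hδ hQ g
  obtain ⟨e, ⟨z, h0⟩, hb, ha⟩ := exists_idempotent_mod_dvd hδ (f q₁) (g q₂)
  obtain ⟨t, r, h1⟩ := Ideal.mem_span_pair.1 hb
  obtain ⟨u, r', h2⟩ := Ideal.mem_span_pair.1 ha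
  obtain ⟨t₀, s₀, hl⟩ := Ideal.mem_span_pair.1 (H₁ q₂ hq₂)
  -- Modulo `δ`: where `e = 1`, the value is `f q₁`, which divides `g q₂`. Where `e = 0`, the point
  -- is `q₂` and `f q₂ = t₀ u g q₂`, so the value is `g q₂`, which divides `f q₁`.
  refine ⟨(1 - e) * (1 - t₀ * u), e • q₁ + (1 - e) • q₂,
    Q.add_mem (Q.smul_mem _ hq₁) (Q.smul_mem _ hq₂), ?_⟩
  set v := (f + ((1 - e) * (1 - t₀ * u)) • g) (e • q₁ + (1 - e) • q₂) with hv
  simp only [LinearMap.add_apply, LinearMap.smul_apply, map_add, map_smul, smul_eq_mul] at hv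
  set J := Ideal.span {v, δ}
  have hδJ : δ ∈ J := Ideal.subset_span (by simp)
  have hea : e * f q₁ ∈ J := by
    refine Ideal.mem_span_pair.2 ⟨e, z * (f q₁ - f q₂ -
      (1 - t₀ * u) * (e * g q₁ + (1 - e) * g q₂)), ?_⟩
    rw [hv]
    linear_combination (-f q₁ + f q₂ + (1 - t₀ * u) * (e * g q₁ + (1 - e) * g q₂)) * h0
  have heb : (1 - e) * g q₂ ∈ J := by
    refine Ideal.mem_span_pair.2 ⟨1 - e, -(z * f q₁ + (1 - e) * (t₀ * r' + (1 - e) * s₀) +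
      (1 - e) * (1 - t₀ * u) * z * g q₁ - (1 - t₀ * u) * z * (2 - e) * g q₂), ?_⟩
    rw [hv]
    linear_combination (f q₁ + (1 - e) * (1 - t₀ * u) * g q₁ -
      (1 - t₀ * u) * (2 - e) * g q₂) * h0 - (1 - e) ^ 2 * hl - (1 - e) * t₀ * h2
  have hbJ : g q₂ ∈ J := by
    have : g q₂ = t * (e * f q₁) + (e * r + z * g q₂) * δ + (1 - e) * g q₂ := by
      linear_combination g q₂ * h0 - e * h1
    rw [this]
    exact J.add_mem (J.add_mem (J.mul_mem_left _ hea) (J.mul_mem_left _ hδJ)) heb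
  have haJ : f q₁ ∈ J := by
    have : f q₁ = e * f q₁ + (u * g q₂ + r' * δ) := by linear_combination -h2
    rw [this]
    exact J.add_mem hea (J.add_mem (J.mul_mem_left _ hbJ) (J.mul_mem_left _ hδJ))
  refine fun x hx => ⟨Ideal.span_le.2 ?_ (H₁ x hx), Ideal.span_le.2 ?_ (H₂ x hx)⟩ <;>
  · rintro w (rfl | rfl) <;> assumption

/-- A combination of finitely many linear forms, the first one with coefficient one, has a value
on `Q` which generates together with `δ` an ideal containing all values of all the forms. -/
theorem exists_forall_mem_span_add_sum_smul (hδ : δ ≠ 0) {E ι : Type*} [AddCommGroup E]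
    [Module R E] {Q : Submodule R E} (hQ : Q.FG) (f : E →ₗ[R] R) (g : ι → E →ₗ[R] R)
    (s : Finset ι) :
    ∃ c : ι → R, ∃ q ∈ Q, ∀ x ∈ Q, f x ∈ Ideal.span {(f + ∑ i ∈ s, c i • g i) q, δ} ∧
      ∀ i ∈ s, g i x ∈ Ideal.span {(f + ∑ i ∈ s, c i • g i) q, δ} := by
  classical
  induction s using Finset.induction_on with
  | empty =>
    obtain ⟨q, hq, H⟩ := exists_mem_forall_mem_span hδ hQ f
    exact ⟨0, q, hq, by simpa using H⟩
  | insert j s hj ih =>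
    obtain ⟨c, q, hq, H⟩ := ih
    obtain ⟨d, q', hq', H'⟩ := exists_forall_mem_span_add_smul hδ hQ (f + ∑ i ∈ s, c i • g i) (g j)
    have hsum : f + ∑ i ∈ insert j s, Function.update c j d i • g i =
        f + ∑ i ∈ s, c i • g i + d • g j := by
      rw [Finset.sum_insert hj, Function.update_self, add_comm (d • g j), ← add_assoc]
      congr 2
      refine Finset.sum_congr rfl fun i hi => ?_
      rw [Function.update_of_ne (ne_of_mem_of_not_mem hi hj)]
    refine ⟨Function.update c j d, q', hq', fun x hx => ?_⟩
    rw [hsum]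
    have hle : Ideal.span {(f + ∑ i ∈ s, c i • g i) q, δ} ≤
        Ideal.span {(f + ∑ i ∈ s, c i • g i + d • g j) q', δ} := by
      rw [Ideal.span_le]
      rintro w (rfl | rfl)
      · exact (H' q hq).1
      · exact Ideal.subset_span (by simp)
    refine ⟨hle (H x hx).1, fun i hi => ?_⟩
    obtain rfl | hi := Finset.mem_insert.1 hi
    · exact (H' x hx).2
    · exact hle ((H x hx).2 i hi)

end Arithmetic

/-! ### Stacked bases in `Rⁿ`. -/

/-- Stacked bases with ideal coefficients: a finitely generated submodule of `Rⁿ` which contains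
`δ Rⁿ` is, after a change of basis of `Rⁿ`, the product of a decreasing chain of ideals generated
by `δ` and one further element. -/
theorem exists_linearEquiv_mem_iff_forall_mem_span {R : Type*} [CommRing R] [IsPruferDomain R]
    [Ring.DimensionLEOne R] {δ : R} (hδ : δ ≠ 0) {n : ℕ} {P : Submodule R (Fin n → R)}
    (hP : P.FG) (hδP : ∀ x, δ • x ∈ P) :
    ∃ (L : (Fin n → R) ≃ₗ[R] (Fin n → R)) (a : Fin n → R),
      Antitone (fun i => Ideal.span {a i, δ}) ∧
      ∀ x, x ∈ P ↔ ∀ i, L x i ∈ Ideal.span {a i, δ} := by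
  induction n with
  | zero =>
    refine ⟨LinearEquiv.refl R _, 0, fun i => i.elim0, fun x => ⟨fun _ i => i.elim0, fun _ => ?_⟩⟩
    rw [Subsingleton.elim x 0]
    exact P.zero_mem
  | succ n ih =>
    obtain ⟨c, q, hq, H⟩ := exists_forall_mem_span_add_sum_smul hδ hP
      (LinearMap.proj 0 : (Fin (n + 1) → R) →ₗ[R] R) (fun i : Fin n => LinearMap.proj i.succ)
      Finset.univ
    let h : (Fin n → R) →ₗ[R] R := ∑ i, c i • LinearMap.proj i
    set a₀ := (LinearMap.proj 0 + ∑ i : Fin n, c i • LinearMap.proj i.succ :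
      (Fin (n + 1) → R) →ₗ[R] R) q with ha₀
    have ha₀' : a₀ = q 0 + h (fun i => q i.succ) := by
      simp [ha₀, h]
    set J := Ideal.span {a₀, δ}
    have hδJ : δ ∈ J := Ideal.subset_span (by simp)
    have hPJ : ∀ x ∈ P, ∀ i, x i ∈ J := fun x hx => Fin.cases (H x hx).1
      fun i => (H x hx).2 i (Finset.mem_univ i)
    have hw : ∀ i : Fin n, ∃ w v, w * a₀ + v * δ = q i.succ := fun i =>
      Ideal.mem_span_pair.1 (hPJ q hq i.succ)
    choose w v hwv using hw
    let e := Fin.consLinearEquiv R (fun _ : Fin (n + 1) => R)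
    -- `U₁` adds `h` of the tail to the first coordinate; `U₂` subtracts `w` times the new first
    -- coordinate from the tail. Together they send `q` to `(a₀, δ v)`.
    let U₁ : (R × (Fin n → R)) ≃ₗ[R] R × (Fin n → R) :=
      LinearEquiv.prodComm R R (Fin n → R) ≪≫ₗ
        LinearEquiv.skewProd (LinearEquiv.refl R _) (LinearEquiv.refl R _) h ≪≫ₗ
        LinearEquiv.prodComm R (Fin n → R) R
    let U₂ : (R × (Fin n → R)) ≃ₗ[R] R × (Fin n → R) :=
      LinearEquiv.skewProd (LinearEquiv.refl R _) (LinearEquiv.refl R _)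
        (-(LinearMap.toSpanSingleton R _ w))
    let U := e.symm ≪≫ₗ U₁ ≪≫ₗ U₂
    have hU : ∀ x, U x = (x 0 + h (fun i => x i.succ),
        fun i => x i.succ - (x 0 + h (fun i => x i.succ)) * w i) := by
      intro x
      refine Prod.ext rfl (funext fun i => ?_)
      exact (sub_eq_add_neg (x i.succ) ((x 0 + h (fun i => x i.succ)) * w i)).symm
    let P₂ : Submodule R (R × (Fin n → R)) := P.map (U : (Fin (n + 1) → R) →ₗ[R] _)
    have hδP₂ : ∀ y, δ • y ∈ P₂ := fun y => by
      refine ⟨δ • U.symm y, hδP _, ?_⟩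
      simp
    have hmemP₂ : ∀ x, U x ∈ P₂ ↔ x ∈ P := fun x => by
      simp [P₂]
    have hqP₂ : (a₀, (0 : Fin n → R)) ∈ P₂ := by
      have h1 : U q - δ • ((0 : R), v) = (a₀, 0) := by
        rw [hU, ← ha₀']
        refine Prod.ext (by simp) (funext fun i => ?_)
        simp only [Prod.snd_sub, Prod.smul_snd, Pi.sub_apply, Pi.smul_apply, smul_eq_mul,
          Pi.zero_apply]
        linear_combination -hwv i
      rw [← h1]
      exact P₂.sub_mem ((hmemP₂ q).2 hq) (hδP₂ _)
    have hJP₂ : ∀ t ∈ J, (t, (0 : Fin n → R)) ∈ P₂ := by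
      intro t ht
      obtain ⟨r, s, rfl⟩ := Ideal.mem_span_pair.1 ht
      have : (r * a₀ + s * δ, (0 : Fin n → R)) = r • (a₀, 0) + δ • (s, 0) := by
        ext <;> simp [mul_comm]
      rw [this]
      exact P₂.add_mem (P₂.smul_mem _ hqP₂) (hδP₂ _)
    have hP₂J : ∀ y ∈ P₂, y.1 ∈ J ∧ ∀ i, y.2 i ∈ J := by
      rintro _ ⟨x, hx, rfl⟩
      have h0 : x 0 + h (fun i => x i.succ) ∈ J := by
        refine J.add_mem (hPJ x hx 0) ?_
        simp only [h, LinearMap.sum_apply, LinearMap.smul_apply, LinearMap.proj_apply]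
        exact J.sum_mem fun i _ => J.mul_mem_left _ (hPJ x hx _)
      rw [LinearEquiv.coe_coe, hU]
      exact ⟨h0, fun i => J.sub_mem (hPJ x hx _) (J.mul_mem_right _ h0)⟩
    -- Since `P₂` contains `J × 0` and its first coordinates lie in `J`, it is `J × P'`.
    let P' : Submodule R (Fin n → R) := P₂.map (LinearMap.snd R R (Fin n → R))
    have hP' : P'.FG := (hP.map _).map _
    have hδP' : ∀ y, δ • y ∈ P' := fun y => ⟨δ • (0, y), hδP₂ _, by simp⟩
    have hP₂iff : ∀ y, y ∈ P₂ ↔ y.1 ∈ J ∧ y.2 ∈ P' := by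
      refine fun y => ⟨fun hy => ⟨(hP₂J y hy).1, y, hy, rfl⟩, ?_⟩
      rintro ⟨hy1, y', hy', h2⟩
      have : y = y' + (y.1 - y'.1, 0) := by
        ext
        · simp
        · simp [← h2]
      rw [this]
      exact P₂.add_mem hy' (hJP₂ _ (J.sub_mem hy1 (hP₂J y' hy').1))
    obtain ⟨L', a', hanti, hL'⟩ := ih hP' hδP'
    have hle : ∀ i, Ideal.span {a' i, δ} ≤ J := by
      -- The preimage under `L'` of `a' i` times the `i`-th basis vector is in `P'`, so its
      -- coordinates lie in `J`; applying `L'` keeps them there.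
      intro i
      have hmem : L'.symm (Pi.single i (a' i)) ∈ P' := by
        rw [hL', LinearEquiv.apply_symm_apply]
        intro j
        obtain rfl | hij := eq_or_ne j i
        · rw [Pi.single_eq_same]
          exact Ideal.subset_span (by simp)
        · rw [Pi.single_eq_of_ne hij]
          exact Ideal.zero_mem _
      obtain ⟨y, hy, hyi⟩ := hmem
      have hcoord : ∀ j, L'.symm (Pi.single i (a' i)) j ∈ J := fun j => by
        rw [← hyi]
        exact (hP₂J y hy).2 j
      have := Ideal.map_pi J _ hcoord (L' : (Fin n → R) →ₗ[R] Fin n → R) i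
      rw [LinearEquiv.coe_coe, LinearEquiv.apply_symm_apply, Pi.single_eq_same] at this
      rw [Ideal.span_le]
      rintro z (rfl | rfl) <;> assumption
    refine ⟨U ≪≫ₗ LinearEquiv.prodCongr (LinearEquiv.refl R R) L' ≪≫ₗ e, Fin.cons a₀ a', ?_, ?_⟩
    · intro i j
      refine Fin.cases (fun _ => ?_) (fun i => ?_) i
      · refine Fin.cases le_rfl (fun j => ?_) j
        simpa using hle j
      · refine Fin.cases (fun hij => ?_) (fun j hij => ?_) j
        · exact absurd hij (by simp)
        · simpa using hanti (Fin.succ_le_succ_iff.1 hij)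
    · intro x
      rw [← hmemP₂, hP₂iff, hL', Fin.forall_fin_succ]
      rfl

/-! ### Maximal determinantal ideals. -/

namespace Matrix

variable {R : Type*} [CommRing R] {n m : ℕ}

theorem det_submatrix_mem_determinantalIdeal (M : Matrix (Fin n) (Fin m) R) (g : Fin n → Fin m) :
    (M.submatrix id g).det ∈ M.determinantalIdeal n := by
  by_cases hg : Function.Injective g
  · have hcard : (Finset.univ.image g).card = n := by
      rw [Finset.card_image_of_injective _ hg, Finset.card_fin]
    let f := (Finset.univ.image g).orderEmbOfFin hcard
    have hex : ∀ i, ∃ j, f j = g i := fun i => by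
      have : g i ∈ Set.range f := by simp [f]
      exact this
    choose σ hσ using hex
    have hσi : Function.Injective σ := fun i j hij => hg (by rw [← hσ, ← hσ, hij])
    let τ : Equiv.Perm (Fin n) := Equiv.ofBijective σ (Finite.injective_iff_bijective.1 hσi)
    have hM : M.submatrix id g = (M.submatrix id f).submatrix id τ := by
      ext i j
      simp [τ, hσ]
    rw [hM, det_permute']
    refine Ideal.mul_mem_left _ _ (Ideal.subset_span ⟨(RelEmbedding.refl _, f), rfl⟩)
  · obtain ⟨i, j, hij, hne⟩ := Function.not_injective_iff.1 hg
    rw [det_zero_of_column_eq hne fun k => by simp [hij]]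
    exact Ideal.zero_mem _

/-- A weak Cauchy–Binet formula: the columns of `M * X` are combinations of those of `M`, and the
determinant is expanded multilinearly. -/
theorem det_mem_determinantalIdeal (M : Matrix (Fin n) (Fin m) R) (X : Matrix (Fin m) (Fin n) R) :
    (M * X).det ∈ M.determinantalIdeal n := by
  have h : (M * X)ᵀ = fun j => ∑ k, X k j • Mᵀ k := by
    ext j i
    simp [mul_apply, mul_comm]
  rw [← det_transpose, h]
  change (detRowAlternating : (Fin n → R) [⋀^Fin n]→ₗ[R] R).toMultilinearMap _ ∈ _
  rw [MultilinearMap.map_sum]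
  refine Ideal.sum_mem _ fun g _ => ?_
  rw [MultilinearMap.map_smul_univ]
  refine Ideal.mul_mem_left _ _ ?_
  have := det_submatrix_mem_determinantalIdeal M g
  rwa [← det_transpose] at this

/-- The maximal determinantal ideal of `M` in terms of the column module of `M`. -/
theorem determinantalIdeal_eq_span_det (M : Matrix (Fin n) (Fin m) R) :
    M.determinantalIdeal n =
      Ideal.span {d | ∃ N : Matrix (Fin n) (Fin n) R,
        (∀ j, N.col j ∈ LinearMap.range M.mulVecLin) ∧ N.det = d} := by
  refine le_antisymm (Ideal.span_le.2 ?_) (Ideal.span_le.2 ?_)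
  · rintro _ ⟨⟨f, g⟩, rfl⟩
    have hf : (f : Fin n → Fin n) = id :=
      (StrictMono.range_inj f.strictMono strictMono_id).1
        (by rw [Set.range_id, (Finite.injective_iff_surjective.1 f.injective).range_eq])
    refine Ideal.subset_span ⟨_, fun j => ⟨Pi.single (g j) 1, ?_⟩, rfl⟩
    ext i
    simp [hf]
  · rintro _ ⟨N, hN, rfl⟩
    choose x hx using hN
    have : N = M * (Matrix.of x)ᵀ := by
      ext i j
      have := congrFun (hx j) i
      simpa [mul_apply, mulVec, dotProduct] using this.symm
    rw [this]
    exact det_mem_determinantalIdeal M _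

/-- Cramer's rule: `N.det • x = N (N.adjugate x)` is a combination of the columns of `N`. -/
theorem smul_mem_range_of_mem_determinantalIdeal (M : Matrix (Fin n) (Fin m) R) {d : R}
    (hd : d ∈ M.determinantalIdeal n) (x : Fin n → R) : d • x ∈ LinearMap.range M.mulVecLin := by
  rw [determinantalIdeal_eq_span_det] at hd
  induction hd using Submodule.span_induction with
  | mem d h =>
    obtain ⟨N, hN, rfl⟩ := h
    have : N.det • x = ∑ j, (N.adjugate *ᵥ x) j • N.col j := by
      have h : N *ᵥ (N.adjugate *ᵥ x) = N.det • x := by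
        rw [mulVec_mulVec, mul_adjugate, smul_mulVec, one_mulVec]
      rw [← h]
      ext i
      simp [mulVec, dotProduct, mul_comm]
    rw [this]
    exact Submodule.sum_mem _ fun j _ => Submodule.smul_mem _ _ (hN j)
  | zero => simp
  | add a b _ _ ha hb => rw [add_smul]; exact Submodule.add_mem _ ha hb
  | smul a b _ hb => rw [smul_assoc]; exact Submodule.smul_mem _ _ hb

theorem le_of_determinantalIdeal_ne_bot (M : Matrix (Fin n) (Fin m) R)
    (hM : M.determinantalIdeal n ≠ ⊥) : n ≤ m := by
  by_contra h
  refine hM (Ideal.span_eq_bot.2 ?_)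
  rintro _ ⟨⟨f, g⟩, rfl⟩
  have := Fintype.card_le_of_injective g g.injective
  simp at this
  exact absurd this h

open scoped Pointwise in
/-- If the column module of `M` is, in some basis of `Rⁿ`, a product of ideals, then the maximal
determinantal ideal is the product of these ideals. -/
theorem determinantalIdeal_eq_prod (M : Matrix (Fin n) (Fin m) R)
    (L : (Fin n → R) ≃ₗ[R] (Fin n → R)) (I : Fin n → Ideal R)
    (hL : ∀ x, x ∈ LinearMap.range M.mulVecLin ↔ ∀ i, L x i ∈ I i) :
    M.determinantalIdeal n = ∏ i, I i := by
  rw [determinantalIdeal_eq_span_det]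
  have hdet : ∀ N : Matrix (Fin n) (Fin n) R, (LinearMap.toMatrix' (L : _ →ₗ[R] _) * N).det =
      LinearMap.det (L : _ →ₗ[R] _) * N.det := fun N => by
    rw [det_mul, LinearMap.det_toMatrix']
  have hcol : ∀ (N : Matrix (Fin n) (Fin n) R) (j i),
      (LinearMap.toMatrix' (L : (Fin n → R) →ₗ[R] _) * N) i j = L (N.col j) i := fun N j i => by
    have := congrFun (LinearMap.toMatrix'_mulVec (L : (Fin n → R) →ₗ[R] _) (N.col j)) i
    rw [LinearEquiv.coe_coe] at this
    rw [← this]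
    rfl
  have hu : IsUnit (LinearMap.det (L : (Fin n → R) →ₗ[R] _)) := L.isUnit_det'
  refine le_antisymm (Ideal.span_le.2 ?_) ?_
  · rintro _ ⟨N, hN, rfl⟩
    -- As `det L` is a unit, `N` may be replaced by `L N`, whose `i`-th row has entries in `I i`;
    -- each Leibniz term then lies in the product.
    rw [SetLike.mem_coe, ← Ideal.unit_mul_mem_iff_mem _ hu, ← hdet, det_apply]
    refine Ideal.sum_mem _ fun σ _ => ?_
    rw [Units.smul_def, zsmul_eq_mul]
    refine Ideal.mul_mem_left _ _ ?_
    rw [← Equiv.prod_comp σ I]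
    refine Ideal.prod_mem_prod fun i _ => ?_
    rw [hcol]
    exact (hL _).1 (hN i) _
  · have : ∏ i, I i = Ideal.span (∏ i, (I i : Set R)) := by
      rw [← Ideal.prod_span]
      simp
    rw [this, Ideal.span_le]
    intro d hd
    obtain ⟨x, hx, rfl⟩ := (Set.mem_fintype_prod _ _).1 hd
    -- Conversely, a product of elements `x i ∈ I i` is the determinant of `diagonal x = L N`.
    let N : Matrix (Fin n) (Fin n) R := LinearMap.toMatrix' (L.symm : _ →ₗ[R] _) * diagonal x
    have hN : LinearMap.toMatrix' (L : (Fin n → R) →ₗ[R] _) * N = diagonal x := by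
      rw [← Matrix.mul_assoc, ← LinearMap.toMatrix'_comp]
      simp
    have hd : ∏ i, x i = LinearMap.det (L : (Fin n → R) →ₗ[R] _) * N.det := by
      rw [← hdet, hN, det_diagonal]
    rw [hd]
    refine Ideal.mul_mem_left _ _ (Ideal.subset_span ⟨N, fun j => (hL _).2 fun i => ?_, rfl⟩)
    rw [← hcol, hN]
    obtain rfl | hij := eq_or_ne i j
    · rw [diagonal_apply_eq]
      exact hx i
    · rw [diagonal_apply_ne _ hij]
      exact Ideal.zero_mem _

end Matrix

/-! ### Invertibility of finitely generated fractional ideals. -/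

section FractionalIdeal

variable {R K : Type*} [CommRing R] [IsPruferDomain R] [Field K] [Algebra R K]
  [IsFractionRing R K]

variable (K) in
theorem IsPruferDomain.isUnit_coeIdeal {I : Ideal R} (hI : I.FG) (h0 : I ≠ ⊥) :
    IsUnit (I : FractionalIdeal R⁰ K) := by
  obtain ⟨J, -, c, hc, hJ⟩ := IsPruferDomain.exists_mul_eq_span_singleton I hI h0
  have hc' : algebraMap R K c ≠ 0 := by simpa using hc
  refine isUnit_of_mul_isUnit_left (y := (J : FractionalIdeal R⁰ K)) ?_
  rw [← FractionalIdeal.coeIdeal_mul, hJ, FractionalIdeal.coeIdeal_span_singleton]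
  refine IsUnit.of_mul_eq_one (FractionalIdeal.spanSingleton R⁰ (algebraMap R K c)⁻¹) ?_
  rw [FractionalIdeal.spanSingleton_mul_spanSingleton, mul_inv_cancel₀ hc',
    FractionalIdeal.spanSingleton_one]

theorem IsPruferDomain.exists_unit_coe_eq {N : Submodule R K} (hN : N.FG) (h0 : N ≠ ⊥) :
    ∃ u : (FractionalIdeal R⁰ K)ˣ, ((u : FractionalIdeal R⁰ K) : Submodule R K) = N := by
  obtain ⟨F, rfl⟩ : ∃ F : FractionalIdeal R⁰ K, (F : Submodule R K) = N :=
    ⟨⟨N, FractionalIdeal.isFractional_of_fg hN⟩, rfl⟩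
  obtain ⟨a, I, ha, hI⟩ := FractionalIdeal.exists_eq_spanSingleton_mul F
  have ha' : algebraMap R K a ≠ 0 := by simpa using ha
  have hua : IsUnit (FractionalIdeal.spanSingleton R⁰ (algebraMap R K a)⁻¹) := by
    refine IsUnit.of_mul_eq_one (FractionalIdeal.spanSingleton R⁰ (algebraMap R K a)) ?_
    rw [FractionalIdeal.spanSingleton_mul_spanSingleton, inv_mul_cancel₀ ha',
      FractionalIdeal.spanSingleton_one]
  have hIN : (I : FractionalIdeal R⁰ K) = FractionalIdeal.spanSingleton R⁰ (algebraMap R K a) * F := by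
    rw [hI, ← mul_assoc, FractionalIdeal.spanSingleton_mul_spanSingleton, mul_inv_cancel₀ ha',
      FractionalIdeal.spanSingleton_one, one_mul]
  have hIfg : I.FG := by
    rw [← FractionalIdeal.coeIdeal_fg R⁰ (IsFractionRing.injective R K), hIN,
      FractionalIdeal.coe_mul, FractionalIdeal.coe_spanSingleton]
    exact (Submodule.fg_span_singleton _).mul hN
  have hI0 : I ≠ ⊥ := by
    rintro rfl
    rw [FractionalIdeal.coeIdeal_bot, mul_zero] at hI
    exact h0 (by simp [hI])
  obtain ⟨u, hu⟩ := hua.mul (IsPruferDomain.isUnit_coeIdeal K hIfg hI0)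
  exact ⟨u, by rw [hu, ← hI]⟩

end FractionalIdeal

/-! ### Pseudo-bases and splitting. -/

section PseudoBasis

variable {R K : Type*} [CommRing R] [Field K] [Algebra R K]
  {W V : Type*} [AddCommGroup W] [Module R W] [Module K W] [IsScalarTower R K W]
  [AddCommGroup V] [Module K V]

/-- Invertible fractional ideals are projective: a lift of the multiples of `v` by elements of
`𝔞` comes from a lift of `v`. -/
theorem exists_apply_eq_forall_smul_mem (𝔞 : (FractionalIdeal R⁰ K)ˣ) (N : Submodule R W)
    (f : W →ₗ[K] V) (v : V)
    (h : ∀ a ∈ (𝔞 : FractionalIdeal R⁰ K), ∃ x ∈ N, f x = a • v) :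
    ∃ w, f w = v ∧ ∀ a ∈ (𝔞 : FractionalIdeal R⁰ K), a • w ∈ N := by
  -- If `1 = ∑ iₖ jₖ` with `iₖ ∈ 𝔞`, `jₖ ∈ 𝔞⁻¹`, and `xₖ` lifts `iₖ v`, then `∑ jₖ xₖ` is the lift
  -- sought. The claim for all `r` makes this an induction on sums.
  have key : ∀ r ∈ (𝔞 : FractionalIdeal R⁰ K) * ((𝔞⁻¹ : (FractionalIdeal R⁰ K)ˣ) : _),
      ∃ w, f w = r • v ∧ ∀ a ∈ (𝔞 : FractionalIdeal R⁰ K), a • w ∈ N := by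
    intro r hr
    refine FractionalIdeal.mul_induction_on hr ?_ ?_
    · intro i hi j hj
      obtain ⟨x, hx, hfx⟩ := h i hi
      refine ⟨j • x, by rw [map_smul, hfx, smul_smul, mul_comm], fun a ha => ?_⟩
      have haj := FractionalIdeal.mul_mem_mul ha hj
      rw [Units.mul_inv, FractionalIdeal.mem_one_iff] at haj
      obtain ⟨s, hs⟩ := haj
      rw [smul_smul, ← hs, algebraMap_smul]
      exact N.smul_mem s hx
    · rintro r s ⟨w, hw, hwN⟩ ⟨w', hw', hwN'⟩
      refine ⟨w + w', by rw [map_add, hw, hw', add_smul], fun a ha => ?_⟩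
      rw [smul_add]
      exact N.add_mem (hwN a ha) (hwN' a ha)
  rw [Units.mul_inv] at key
  simpa using key 1 (FractionalIdeal.one_mem_one R⁰)

theorem exists_mem_ne_zero [IsDomain R] [IsFractionRing R K]
    (𝔞 : (FractionalIdeal R⁰ K)ˣ) : ∃ a ∈ (𝔞 : FractionalIdeal R⁰ K), a ≠ 0 := by
  by_contra! h
  exact 𝔞.ne_zero (FractionalIdeal.eq_zero_iff.2 h)

variable [IsPruferDomain R] [IsFractionRing R K]

/-- A finitely generated submodule of a vector space over the field of fractions of a Prüfer
domain has a pseudo-basis. -/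
theorem exists_pseudoBasis [Module.Finite K W] (N : Submodule R W) (hN : N.FG) :
    ∃ (d : ℕ) (b : Fin d → W) (𝔟 : Fin d → (FractionalIdeal R⁰ K)ˣ), LinearIndependent K b ∧
      ∀ x, x ∈ N ↔ ∃ c : Fin d → K, (∀ j, c j ∈ (𝔟 j : FractionalIdeal R⁰ K)) ∧
        ∑ j, c j • b j = x := by
  induction hk : Module.finrank K (Submodule.span K (N : Set W)) using Nat.strong_induction_on
    generalizing N with
  | _ k ih =>
    obtain rfl | hN0 := eq_or_ne N ⊥
    · exact ⟨0, 0, 1, linearIndependent_empty_type, fun x => by simp [eq_comm]⟩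
    · obtain ⟨x₀, hx₀, hx₀'⟩ := Submodule.exists_mem_ne_zero_of_ne_bot hN0
      obtain ⟨f, hf⟩ : ∃ f : W →ₗ[K] K, f x₀ ≠ 0 := by
        by_contra! h
        exact hx₀' ((Module.forall_dual_apply_eq_zero_iff K x₀).1 h)
      obtain ⟨𝔞, h𝔞⟩ := IsPruferDomain.exists_unit_coe_eq (hN.map (f.restrictScalars R))
        (fun h => hf ((Submodule.eq_bot_iff _).1 h _ ⟨x₀, hx₀, rfl⟩))
      have h𝔞' : ∀ a, a ∈ (𝔞 : FractionalIdeal R⁰ K) ↔ ∃ x ∈ N, f x = a := fun a => by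
        rw [← FractionalIdeal.mem_coe, h𝔞]
        rfl
      obtain ⟨w, hw, hwN⟩ := exists_apply_eq_forall_smul_mem 𝔞 N f 1
        (fun a ha => by simpa using (h𝔞' a).1 ha)
      -- `p` projects `N` onto `N ∩ ker f` along `𝔞 w`; the `K`-span of the image is smaller because
      -- `f x₀ ≠ 0`.
      let p : W →ₗ[K] W := LinearMap.id - f.smulRight w
      have hp : ∀ x, p x = x - f x • w := fun x => rfl
      have hfp : ∀ x, f (p x) = 0 := fun x => by
        rw [hp, map_sub, map_smul, hw, smul_eq_mul, mul_one, sub_self]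
      let N' := N.map (p.restrictScalars R)
      have hN' : ∀ x, x ∈ N' ↔ x ∈ N ∧ f x = 0 := by
        refine fun x => ⟨?_, fun hx => ⟨x, hx.1, ?_⟩⟩
        · rintro ⟨y, hy, rfl⟩
          exact ⟨N.sub_mem hy (hwN _ ((h𝔞' _).2 ⟨y, hy, rfl⟩)), hfp y⟩
        · rw [LinearMap.restrictScalars_apply, hp, hx.2, zero_smul, sub_zero]
      have hlt : Submodule.span K (N' : Set W) < Submodule.span K (N : Set W) := by
        refine lt_of_le_of_ne (Submodule.span_mono fun x hx => ((hN' x).1 hx).1) fun h => hf ?_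
        have hle : Submodule.span K (N' : Set W) ≤ LinearMap.ker f :=
          Submodule.span_le.2 fun x hx => ((hN' x).1 hx).2
        exact hle (h ▸ Submodule.subset_span hx₀)
      obtain ⟨d, b, 𝔟, hb, hbN⟩ := ih _ (hk ▸ Submodule.finrank_lt_finrank_of_lt hlt) N'
        (hN.map _) rfl
      have hfb : ∀ j, f (b j) = 0 := by
        intro j
        obtain ⟨a, ha, ha0⟩ := exists_mem_ne_zero (𝔟 j)
        have hmem : a • b j ∈ N' := by
          refine (hbN _).2 ⟨Pi.single j a, fun i => ?_, ?_⟩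
          · obtain rfl | hij := eq_or_ne i j
            · rwa [Pi.single_eq_same]
            · rw [Pi.single_eq_of_ne hij]
              exact Submodule.zero_mem ((𝔟 i : FractionalIdeal R⁰ K) : Submodule R K)
          · simp [Pi.single_apply, ite_smul]
        simpa [ha0] using ((hN' _).1 hmem).2
      refine ⟨d + 1, Fin.cons w b, Fin.cons 𝔞 𝔟, linearIndependent_finCons.2 ⟨hb, fun h => ?_⟩,
        fun x => ⟨fun hx => ?_, ?_⟩⟩
      · have hle : Submodule.span K (Set.range b) ≤ LinearMap.ker f :=
          Submodule.span_le.2 (by rintro _ ⟨j, rfl⟩; exact hfb j)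
        exact one_ne_zero (hw.symm.trans (hle h))
      · obtain ⟨c, hc, hcx⟩ := (hbN (p x)).1 ⟨x, hx, rfl⟩
        refine ⟨Fin.cons (f x) c, Fin.cases ((h𝔞' _).2 ⟨x, hx, rfl⟩) hc, ?_⟩
        simp [Fin.sum_univ_succ, hcx, hp]
      · rintro ⟨c, hc, rfl⟩
        rw [Fin.sum_univ_succ]
        refine N.add_mem (hwN _ (hc 0)) ((hN' _).1 ((hbN _).2 ⟨fun j => c j.succ, fun j => ?_, ?_⟩)).1
        · exact hc j.succ
        · simp

/-- A surjection of a finitely generated module spanning a vector space onto a product of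
invertible ideals splits, and the resulting pseudo-basis can be completed. -/
theorem exists_pseudoBasis_of_surjective [Module.Finite K W] {N : Submodule R W} (hN : N.FG)
    (hspan : Submodule.span K (N : Set W) = ⊤) {n : ℕ} (f : W →ₗ[K] Fin n → K)
    (𝔞 : Fin n → (FractionalIdeal R⁰ K)ˣ)
    (hf : ∀ x ∈ N, ∀ i, f x i ∈ (𝔞 i : FractionalIdeal R⁰ K))
    (hsurj : ∀ y, (∀ i, y i ∈ (𝔞 i : FractionalIdeal R⁰ K)) → ∃ x ∈ N, f x = y) :
    ∃ (d : ℕ) (B : Module.Basis (Fin n ⊕ Fin d) K W) (𝔟 : Fin d → (FractionalIdeal R⁰ K)ˣ),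
      (∀ i, f (B (Sum.inl i)) = Pi.single i 1) ∧ (∀ j, f (B (Sum.inr j)) = 0) ∧
      ∀ x, x ∈ N ↔ ∀ k, B.repr x k ∈
        ((Sum.elim 𝔞 𝔟 k : (FractionalIdeal R⁰ K)ˣ) : FractionalIdeal R⁰ K) := by
  have hw : ∀ i, ∃ w, f w = Pi.single i 1 ∧ ∀ a ∈ (𝔞 i : FractionalIdeal R⁰ K), a • w ∈ N := by
    refine fun i => exists_apply_eq_forall_smul_mem (𝔞 i) N f _ fun a ha => hsurj _ fun j => ?_
    obtain rfl | hij := eq_or_ne j i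
    · simpa using ha
    · rw [Pi.smul_apply, Pi.single_eq_of_ne hij, smul_zero]
      exact Submodule.zero_mem ((𝔞 j : FractionalIdeal R⁰ K) : Submodule R K)
  choose w hw hwN using hw
  let p : W →ₗ[K] W := LinearMap.id - ∑ i, (LinearMap.proj i ∘ₗ f).smulRight (w i)
  have hp : ∀ x, p x = x - ∑ i, f x i • w i := fun x => by simp [p]
  have hfp : ∀ x, f (p x) = 0 := fun x => by
    rw [hp, map_sub, map_sum, sub_eq_zero]
    ext i
    simp [hw, Pi.single_apply]
  have hpN : ∀ x ∈ N, p x ∈ N := fun x hx => by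
    rw [hp]
    exact N.sub_mem hx (N.sum_mem fun i _ => hwN i _ (hf x hx i))
  obtain ⟨d, b, 𝔟, hb, hbN⟩ := exists_pseudoBasis (K := K) (N.map (p.restrictScalars R)) (hN.map _)
  have hN' : ∀ x ∈ N.map (p.restrictScalars R), x ∈ N ∧ f x = 0 := by
    rintro _ ⟨y, hy, rfl⟩
    exact ⟨hpN y hy, hfp y⟩
  have hbsmul : ∀ j, ∀ a ∈ (𝔟 j : FractionalIdeal R⁰ K),
      a • b j ∈ N.map (p.restrictScalars R) := by
    refine fun j a ha => (hbN _).2 ⟨Pi.single j a, fun i => ?_, ?_⟩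
    · obtain rfl | hij := eq_or_ne i j
      · rwa [Pi.single_eq_same]
      · rw [Pi.single_eq_of_ne hij]
        exact Submodule.zero_mem ((𝔟 i : FractionalIdeal R⁰ K) : Submodule R K)
    · simp [Pi.single_apply, ite_smul]
  have hfb : ∀ j, f (b j) = 0 := by
    intro j
    -- `b j` itself need not lie in the lattice, but a nonzero multiple of it does, and is killed by
    -- `f`.
    obtain ⟨a, ha, ha0⟩ := exists_mem_ne_zero (𝔟 j)
    have := (hN' _ (hbsmul j a ha)).2
    rw [map_smul] at this
    exact (smul_eq_zero.1 this).resolve_left ha0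
  have hli : LinearIndependent K (Sum.elim w b) := by
    rw [Fintype.linearIndependent_iff]
    intro g hg
    simp only [Fintype.sum_sum_type, Sum.elim_inl, Sum.elim_inr] at hg
    have h1 : ∀ i, g (Sum.inl i) = 0 := by
      intro i
      have := congrFun (congrArg f hg) i
      simpa [hw, hfb, Pi.single_apply] using this
    have h2 : ∀ j, g (Sum.inr j) = 0 :=
      Fintype.linearIndependent_iff.1 hb _ (by simpa [h1] using hg)
    rintro (i | j)
    exacts [h1 i, h2 j]
  have hdecomp : ∀ x ∈ N, ∃ c : Fin d → K, (∀ j, c j ∈ (𝔟 j : FractionalIdeal R⁰ K)) ∧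
      ∑ k, Sum.elim (f x) c k • Sum.elim w b k = x := by
    intro x hx
    obtain ⟨c, hc, hcx⟩ := (hbN (p x)).1 ⟨x, hx, rfl⟩
    exact ⟨c, hc, by simp [Fintype.sum_sum_type, hcx, hp]⟩
  have hsp : ⊤ ≤ Submodule.span K (Set.range (Sum.elim w b)) := by
    rw [← hspan, Submodule.span_le]
    intro x hx
    obtain ⟨c, -, hc⟩ := hdecomp x hx
    rw [← hc]
    exact Submodule.sum_mem _ fun k _ => Submodule.smul_mem _ _ (Submodule.subset_span ⟨k, rfl⟩)
  let B := Module.Basis.mk hli hsp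
  have hB : ⇑B = Sum.elim w b := Module.Basis.coe_mk hli hsp
  refine ⟨d, B, 𝔟, fun i => by rw [hB]; exact hw i, fun j => by rw [hB]; exact hfb j,
    fun x => ⟨fun hx => ?_, fun hx => ?_⟩⟩
  · obtain ⟨c, hc, hcx⟩ := hdecomp x hx
    have : ⇑(B.repr x) = Sum.elim (f x) c := by
      rw [← B.repr_sum_self (Sum.elim (f x) c), hB, hcx]
    rw [this]
    rintro (i | j)
    exacts [hf x hx i, hc j]
  · rw [← B.sum_repr x, hB, Fintype.sum_sum_type]
    exact N.add_mem (N.sum_mem fun i _ => hwN i _ (hx (Sum.inl i)))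
      (N.sum_mem fun j _ => (hN' _ (hbsmul j _ (hx (Sum.inr j)))).1)

end PseudoBasis

/-! ### The lattice `Rᵐ` and invertible pseudo-matrices. -/

section PseudoBasis

variable {R K : Type*} [CommRing R] [Field K] [Algebra R K] {m : ℕ}

variable (R K m) in
/-- The lattice `Rᵐ` in `Kᵐ`. -/
def standardLattice : Submodule R (Fin m → K) :=
  LinearMap.range ((Algebra.linearMap R K).compLeft (Fin m))

theorem mem_standardLattice {x : Fin m → K} :
    x ∈ standardLattice R K m ↔ ∀ j, ∃ r, algebraMap R K r = x j := by
  refine ⟨?_, fun h => ?_⟩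
  · rintro ⟨y, rfl⟩ j
    exact ⟨y j, rfl⟩
  · choose y hy using h
    exact ⟨y, funext hy⟩

theorem standardLattice_fg : (standardLattice R K m).FG := by
  rw [standardLattice, LinearMap.range_eq_map]
  exact Module.Finite.fg_top.map _

theorem single_mem_standardLattice (j : Fin m) :
    Pi.single j (1 : K) ∈ standardLattice R K m := by
  refine mem_standardLattice.2 fun i => ?_
  obtain rfl | hij := eq_or_ne i j
  · exact ⟨1, by simp⟩
  · exact ⟨0, by simp [hij]⟩

theorem span_standardLattice :
    Submodule.span K (standardLattice R K m : Set (Fin m → K)) = ⊤ := by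
  rw [eq_top_iff, ← (Pi.basisFun K (Fin m)).span_eq, Submodule.span_le]
  rintro _ ⟨j, rfl⟩
  rw [Pi.basisFun_apply]
  exact Submodule.subset_span (single_mem_standardLattice j)

theorem PseudoMatrix.isInvertible_ofMatrix {n : ℕ} {A B : Matrix (Fin n) (Fin n) R}
    (h : A * B = 1) (h' : B * A = 1) : (ofMatrix A : PseudoMatrix (K := K) _ _).IsInvertible := by
  refine ⟨ofMatrix B, PseudoMatrix.ext ?_, PseudoMatrix.ext ?_⟩
  · exact (Matrix.map_mul (f := algebraMap R K)).symm.trans (by simp [h, one])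
  · exact (Matrix.map_mul (f := algebraMap R K)).symm.trans (by simp [h', one])

/-- A pseudo-basis of `Rᵐ` gives an invertible pseudo-matrix. -/
theorem exists_isInvertible_of_pseudoBasis (B : Module.Basis (Fin m) K (Fin m → K))
    (𝔞 : Fin m → (FractionalIdeal R⁰ K)ˣ)
    (hB : ∀ x, x ∈ standardLattice R K m ↔ ∀ k, B.repr x k ∈ (𝔞 k : FractionalIdeal R⁰ K)) :
    ∃ C : PseudoMatrix (fun _ : Fin m => (1 : (FractionalIdeal R⁰ K)ˣ)) 𝔞,
      C.IsInvertible ∧ C.mat = Matrix.of fun j k => B k j := by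
  let C : PseudoMatrix (fun _ : Fin m => (1 : (FractionalIdeal R⁰ K)ˣ)) 𝔞 :=
    { mat := (Pi.basisFun K (Fin m)).toMatrix B
      mul_mem := by
        intro i j x hx
        have hmem : x • B j ∈ standardLattice R K m := by
          refine (hB _).2 fun k => ?_
          rw [map_smul, B.repr_self, Finsupp.smul_single, smul_eq_mul, mul_one]
          obtain rfl | hjk := eq_or_ne j k
          · rwa [Finsupp.single_eq_same]
          · rw [Finsupp.single_eq_of_ne hjk.symm]
            exact Submodule.zero_mem ((𝔞 k : FractionalIdeal R⁰ K) : Submodule R K)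
        obtain ⟨r, hr⟩ := mem_standardLattice.1 hmem i
        rw [Units.val_one, FractionalIdeal.mem_one_iff]
        exact ⟨r, by simp [hr, Module.Basis.toMatrix_apply, mul_comm]⟩ }
  let D : PseudoMatrix 𝔞 (fun _ : Fin m => (1 : (FractionalIdeal R⁰ K)ˣ)) :=
    { mat := B.toMatrix (Pi.basisFun K (Fin m))
      mul_mem := by
        intro i j x hx
        rw [Units.val_one, FractionalIdeal.mem_one_iff] at hx
        obtain ⟨r, rfl⟩ := hx
        have := (hB _).1 (single_mem_standardLattice j) i
        rw [mul_comm, ← Algebra.smul_def, Module.Basis.toMatrix_apply, Pi.basisFun_apply]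
        exact Submodule.smul_mem ((𝔞 i : FractionalIdeal R⁰ K) : Submodule R K) r this }
  refine ⟨C, ⟨D, PseudoMatrix.ext ?_, PseudoMatrix.ext ?_⟩, ?_⟩
  · exact Module.Basis.toMatrix_mul_toMatrix_flip _ _
  · exact Module.Basis.toMatrix_mul_toMatrix_flip _ _
  · ext j k
    simp [C, Module.Basis.toMatrix_apply]

/-- A pseudo-basis of `Rᵐ` decomposes `Rᵐ` as a direct sum of ideals. -/
theorem nonempty_directSum_linearEquiv_of_pseudoBasis [IsDomain R] [IsFractionRing R K]
    (B : Module.Basis (Fin m) K (Fin m → K)) (𝔞 : Fin m → (FractionalIdeal R⁰ K)ˣ)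
    (hB : ∀ x, x ∈ standardLattice R K m ↔ ∀ k, B.repr x k ∈ (𝔞 k : FractionalIdeal R⁰ K)) :
    Nonempty ((⨁ k : Fin m, ((𝔞 k : FractionalIdeal R⁰ K) : Submodule R K)) ≃ₗ[R]
      (Fin m → R)) := by
  let g : (Fin m → R) →ₗ[R] (∀ k, ((𝔞 k : FractionalIdeal R⁰ K) : Submodule R K)) :=
    LinearMap.pi fun k => LinearMap.codRestrict _
      (((B.coord k).restrictScalars R) ∘ₗ (Algebra.linearMap R K).compLeft (Fin m))
      (fun x => (hB _).1 ⟨x, rfl⟩ k)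
  have hg : ∀ x k, (g x k : K) = B.repr ((Algebra.linearMap R K).compLeft (Fin m) x) k :=
    fun x k => rfl
  refine ⟨DirectSum.linearEquivFunOnFintype R _ _ ≪≫ₗ (LinearEquiv.ofBijective g ⟨?_, ?_⟩).symm⟩
  · intro x y hxy
    have : B.repr ((Algebra.linearMap R K).compLeft (Fin m) x) =
        B.repr ((Algebra.linearMap R K).compLeft (Fin m) y) := by
      ext k
      rw [← hg, ← hg, hxy]
    exact funext fun j => IsFractionRing.injective R K (congrFun (B.repr.injective this) j)
  · intro c
    have hc : B.repr (∑ k, (c k : K) • B k) = Finsupp.equivFunOnFinite.symm fun k => (c k : K) := by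
      ext k
      exact congrFun (B.repr_sum_self _) k
    obtain ⟨x, hx⟩ := (hB (∑ k, (c k : K) • B k)).2 fun k => by
      rw [hc]
      exact (c k).2
    refine ⟨x, funext fun k => Subtype.ext ?_⟩
    rw [hg, hx, hc]
    rfl

end PseudoBasis

/-! ### The reduction theorem. -/

theorem mainTheorem5 {R K : Type*} [CommRing R] [IsPruferDomain R] [Ring.DimensionLEOne R]
    [Field K] [Algebra R K] [IsFractionRing R K] {n m : ℕ} (M : Matrix (Fin n) (Fin m) R)
    (hM : M.determinantalIdeal n ≠ ⊥) (δ : R) (hδ : δ ≠ 0) (hδM : δ ∈ M.determinantalIdeal n) :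
    ∃ (hnm : n ≤ m) (𝔞 : Fin m → (FractionalIdeal R⁰ K)ˣ)
      (M₁ : PseudoMatrix (fun _ : Fin n => (1 : (FractionalIdeal R⁰ K)ˣ)) 𝔞),
      M₁.mat = Matrix.of (fun (i : Fin n) (j : Fin m) => if (i : ℕ) = (j : ℕ) then 1 else 0) ∧
      PseudoMatrix.Equivalent (PseudoMatrix.ofMatrix M) M₁ ∧
      Antitone (fun i : Fin n => (𝔞 (Fin.castLE hnm i) : FractionalIdeal R⁰ K)) ∧
      ∏ i : Fin n, (𝔞 (Fin.castLE hnm i) : FractionalIdeal R⁰ K) =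
        (M.determinantalIdeal n : FractionalIdeal R⁰ K) ∧
      (∀ i : Fin n, ∃ a : R, (𝔞 (Fin.castLE hnm i) : FractionalIdeal R⁰ K) =
        (Ideal.span {a, δ} : Ideal R)) ∧
      Nonempty ((⨁ k : Fin m, ((𝔞 k : FractionalIdeal R⁰ K) : Submodule R K)) ≃ₗ[R]
        (Fin m → R)) := by
  have hnm := M.le_of_determinantalIdeal_ne_bot hM
  obtain ⟨L, a, hanti, hL⟩ := exists_linearEquiv_mem_iff_forall_mem_span hδ
    (P := LinearMap.range M.mulVecLin)
    (by rw [LinearMap.range_eq_map]; exact Module.Finite.fg_top.map _)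
    (M.smul_mem_range_of_mem_determinantalIdeal hδM)
  have hunit : ∀ i, IsUnit ((Ideal.span {a i, δ} : Ideal R) : FractionalIdeal R⁰ K) := fun i =>
    IsPruferDomain.isUnit_coeIdeal K (Submodule.fg_span (Set.toFinite _)) fun h =>
      hδ (Ideal.span_eq_bot.1 h δ (by simp))
  choose 𝔞 h𝔞 using hunit
  let A : Matrix (Fin n) (Fin n) R := LinearMap.toMatrix' (L : (Fin n → R) →ₗ[R] _)
  let A' : Matrix (Fin n) (Fin n) R := LinearMap.toMatrix' (L.symm : (Fin n → R) →ₗ[R] _)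
  have hAA' : A * A' = 1 := by
    simp only [A, A', ← LinearMap.toMatrix'_comp]
    simp
  have hA'A : A' * A = 1 := by
    simp only [A, A', ← LinearMap.toMatrix'_comp]
    simp
  -- By the choice of `L`, `f` maps `Rᵐ` onto the product of the `𝔞 i`. The row change `A` is
  -- invertible over `R`, so the row ideals stay trivial.
  let f : (Fin m → K) →ₗ[K] Fin n → K := ((A * M).map (algebraMap R K)).mulVecLin
  have hf : ∀ x : Fin m → R, ∀ i, f ((Algebra.linearMap R K).compLeft (Fin m) x) i =
      algebraMap R K (L (M.mulVecLin x) i) := by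
    intro x i
    have h1 : L (M.mulVecLin x) = (A * M).mulVec x := by
      rw [← Matrix.mulVec_mulVec]
      exact (LinearMap.toMatrix'_mulVec (L : (Fin n → R) →ₗ[R] Fin n → R) _).symm
    rw [h1, RingHom.map_mulVec]
    rfl
  obtain ⟨d, B, 𝔟, hB1, hB2, hB⟩ := exists_pseudoBasis_of_surjective (standardLattice_fg (R := R))
    span_standardLattice f 𝔞
    (by
      rintro _ ⟨x, rfl⟩ i
      rw [hf, h𝔞]
      exact FractionalIdeal.mem_coeIdeal_of_mem _ ((hL _).1 ⟨x, rfl⟩ i))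
    (by
      intro y hy
      simp only [h𝔞, FractionalIdeal.mem_coeIdeal] at hy
      choose z hz hzy using hy
      obtain ⟨x, hx⟩ := (hL (L.symm z)).2 (by simpa using hz)
      refine ⟨_, ⟨x, rfl⟩, funext fun i => ?_⟩
      rw [hf, hx, LinearEquiv.apply_symm_apply, hzy])
  obtain rfl : n + d = m := by
    simpa using (Module.finrank_eq_card_basis B).symm
  have hBr : ∀ x, x ∈ standardLattice R K (n + d) ↔ ∀ k, (B.reindex finSumFinEquiv).repr x k ∈
      ((Sum.elim 𝔞 𝔟 (finSumFinEquiv.symm k) : (FractionalIdeal R⁰ K)ˣ) :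
        FractionalIdeal R⁰ K) := by
    intro x
    rw [hB, ← finSumFinEquiv.symm.forall_congr_right]
    simp
  obtain ⟨C, hC, hCmat⟩ := exists_isInvertible_of_pseudoBasis _ _ hBr
  have h𝔞' : ∀ i : Fin n, ((Sum.elim 𝔞 𝔟 (finSumFinEquiv.symm (Fin.castLE hnm i)) :
      (FractionalIdeal R⁰ K)ˣ) : FractionalIdeal R⁰ K) = (Ideal.span {a i, δ} : Ideal R) := by
    intro i
    have : finSumFinEquiv.symm (Fin.castLE hnm i) = (Sum.inl i : Fin n ⊕ Fin d) :=
      finSumFinEquiv_symm_apply_castAdd i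
    rw [this, Sum.elim_inl, h𝔞]
  refine ⟨hnm, _, ((PseudoMatrix.ofMatrix A).mul (PseudoMatrix.ofMatrix M)).mul C, ?_,
    ⟨_, C, PseudoMatrix.isInvertible_ofMatrix hAA' hA'A, hC, rfl⟩, ?_, ?_, fun i => ⟨a i, h𝔞' i⟩,
    nonempty_directSum_linearEquiv_of_pseudoBasis _ _ hBr⟩
  · have hAM : ((PseudoMatrix.ofMatrix A).mul (PseudoMatrix.ofMatrix M) :
        PseudoMatrix (K := K) _ _).mat = (A * M).map (algebraMap R K) :=
      (Matrix.map_mul (f := algebraMap R K)).symm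
    -- Columns of the product are the images under `f` of the pseudo-basis: unit vectors for the
    -- lifted part, zero for the kernel part.
    have hmat : ∀ i k, ((((PseudoMatrix.ofMatrix A).mul (PseudoMatrix.ofMatrix M)).mul C).mat) i k =
        f (B.reindex finSumFinEquiv k) i := by
      intro i k
      have : (((PseudoMatrix.ofMatrix A).mul (PseudoMatrix.ofMatrix M)).mul C).mat =
          (A * M).map (algebraMap R K) * C.mat := by
        rw [← hAM]
        rfl
      rw [this, hCmat]
      rfl
    ext i k
    rw [hmat, Matrix.of_apply, Module.Basis.reindex_apply]
    refine Fin.addCases (fun k => ?_) (fun k => ?_) k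
    · rw [finSumFinEquiv_symm_apply_castAdd, hB1, Pi.single_apply]
      simp [Fin.ext_iff]
    · rw [finSumFinEquiv_symm_apply_natAdd, hB2, if_neg]
      · rfl
      · simp only [Fin.val_natAdd]
        omega
  · intro i j hij
    simp only [h𝔞']
    exact FractionalIdeal.coeIdeal_le_coeIdeal K |>.2 (hanti hij)
  · simp only [h𝔞']
    rw [M.determinantalIdeal_eq_prod L _ hL]
    exact (map_prod (FractionalIdeal.coeIdealHom R⁰ K) _ _).symm
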